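/- A dimension group is a partially ordered abelian group $G$ that is directed ($G=G^+-G^+$), unperforated ($ng\ge 0$ with $n\ge 1$ implies $g\ge 0$) and has the Riesz interpolation property. An order unit is an element $u\in G^+$ such that every $g\in G$ satisfies $g\le nu$ for some $n\in\mathbf N$. A trace on $G$ is a nonzero group homomorphism $t:G\to\mathbf R$ with $t(G^+)\subseteq[0,\infty)$. It is faithful if $\ker t\cap G^+=\{0\}$, and good if $t([0,b])=t(G)\cap[0,t(b)]$ for every $b\in G^+$, where $[0,b]=\{g\in G: 0\le g\le b\}$. An ECS (equal column sum) realization of $G$ is an isomorphism of ordered groups from $G$ onto a direct limit $\varinjlim M_i:\mathbf Z^{n(i)}\to\mathbf Z^{n(i+1)}$ ($i=1,2,\dots$, $n(i)\ge 1$), with the coordinatewise order on each $\mathbf Z^{n(i)}$ and the direct limit order on the limit, where each $M_i$ is a matrix of nonnegative integers all of whose columns have the same sum $c_i\ge 1$. Its associated trace $\tau$ is given by $\tau([w,j])=\mathbf 1^T w/\prod_{i=1}^{j-1}c_i$ for $w\in\mathbf Z^{n(j)}$. The realization implements a trace $t$ if $t=q\tau$ for some rational $q>0$. Theorem 6.1.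 Let $G$ be a dimension group with order unit and let $t$ be a trace on $G$. (a) If some ECS realization of $G$ implements $t$ (in particular, if $t$ is its associated trace), then $t$ is faithful, good and rational-valued. (b) If $G$ is countable, $t(G)\subseteq\mathbf Q$, and $t$ is faithful and good, then there is an ECS realization of $G$ that implements $t$. If moreover $1\in t(G)$ (for example, if $t$ is normalized at an order unit), the realization can be chosen so that $t$ is exactly its associated trace. -/

import Mathlib

/-- A dimension group: a partially ordered abelian group which is directed (every element is a
difference of positive elements), unperforated (hence torsion-free), and has the Riesz
interpolation property. -/
structure IsDimensionGroup (G : Type*) [AddCommGroup G] [PartialOrder G] [IsOrderedAddMonoid G] :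
    Prop where
  directed : ∀ g : G, ∃ a b : G, 0 ≤ a ∧ 0 ≤ b ∧ g = a - b
  unperforated : ∀ (n : ℕ) (g : G), 0 < n → 0 ≤ n • g → 0 ≤ g
  interpolation : ∀ a₁ a₂ b₁ b₂ : G, a₁ ≤ b₁ → a₁ ≤ b₂ → a₂ ≤ b₁ → a₂ ≤ b₂ →
    ∃ c : G, a₁ ≤ c ∧ a₂ ≤ c ∧ c ≤ b₁ ∧ c ≤ b₂

/-- `u` is an order unit: a positive element whose multiples dominate every element. -/
def IsOrderUnit {G : Type*} [AddCommGroup G] [PartialOrder G] (u : G) : Prop :=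
  0 ≤ u ∧ ∀ g : G, ∃ n : ℕ, g ≤ n • u

/-- A trace: a nonzero positive group homomorphism to the reals (no normalization). -/
def IsTrace {G : Type*} [AddCommGroup G] [PartialOrder G] (t : G →+ ℝ) : Prop :=
  (∀ g : G, 0 ≤ g → 0 ≤ t g) ∧ t ≠ 0

/-- A faithful trace: its kernel meets the positive cone only in zero. -/
def IsFaithfulTrace {G : Type*} [AddCommGroup G] [PartialOrder G] (t : G →+ ℝ) : Prop :=
  ∀ g : G, 0 ≤ g → t g = 0 → g = 0

/-- A good trace: `t([0, b]) = t(G) ∩ [0, t(b)]` for every positive `b`. -/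
def IsGoodTrace {G : Type*} [AddCommGroup G] [PartialOrder G] (t : G →+ ℝ) : Prop :=
  ∀ b : G, 0 ≤ b → t '' Set.Icc 0 b = Set.range t ∩ Set.Icc 0 (t b)

/-- A trace all of whose values are rational. -/
def IsRationalTrace {G : Type*} [AddCommGroup G] (t : G →+ ℝ) : Prop :=
  ∀ g : G, ∃ r : ℚ, t g = (r : ℝ)

/-- A sequence `ℤ^{f 0} → ℤ^{f 1} → ⋯` of simplicial groups of positive ranks, the `i`-th map
being given by an `f (i + 1) × f i` matrix of nonnegative integers. -/
structure SimplicialSequence where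
  size : ℕ → ℕ
  size_pos : ∀ i, 0 < size i
  mat : ∀ i, Matrix (Fin (size (i + 1))) (Fin (size i)) ℕ

namespace SimplicialSequence

variable (S : SimplicialSequence)

/-- The `i`-th simplicial group; functions carry the coordinatewise order. -/
abbrev Level (i : ℕ) : Type := Fin (S.size i) → ℤ

/-- The `i`-th connecting map `v ↦ M_i v`. -/
def step (i : ℕ) : S.Level i →+ S.Level (i + 1) :=
  ((S.mat i).map (Nat.cast : ℕ → ℤ)).mulVecLin.toAddMonoidHom

/-- The composite map `M_{j-1} ⋯ M_i` from level `i` to level `j`. -/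
def trans (i j : ℕ) (h : i ≤ j) : S.Level i →+ S.Level j :=
  Nat.leRec (motive := fun k _ => S.Level i →+ S.Level k) (AddMonoidHom.id _)
    (fun k _ f => (S.step k).comp f) h

theorem trans_self (i : ℕ) : S.trans i i le_rfl = AddMonoidHom.id _ := by
  simp [trans, Nat.leRec_self]

theorem trans_succ {i j : ℕ} (h : i ≤ j) :
    S.trans i (j + 1) (Nat.le_succ_of_le h) = (S.step j).comp (S.trans i j h) := by
  exact Nat.leRec_succ (motive := fun k _ => S.Level i →+ S.Level k) _ _ _

theorem trans_trans {i j k : ℕ} (hij : i ≤ j) (hjk : j ≤ k) (v : S.Level i) :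
    S.trans j k hjk (S.trans i j hij v) = S.trans i k (hij.trans hjk) v := by
  induction hjk with
  | refl => simp [trans_self]
  | step h ih =>
    rw [S.trans_succ h, S.trans_succ (hij.trans h)]
    simp only [AddMonoidHom.comp_apply, ih]

theorem step_nonneg (i : ℕ) {v : S.Level i} (hv : 0 ≤ v) : 0 ≤ S.step i v := by
  intro r
  have h : S.step i v r = ∑ j, (S.mat i r j : ℤ) * v j := rfl
  rw [h]
  exact Finset.sum_nonneg fun j _ => mul_nonneg (Int.natCast_nonneg _) (hv j)

theorem trans_nonneg {i j : ℕ} (h : i ≤ j) {v : S.Level i} (hv : 0 ≤ v) :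
    0 ≤ S.trans i j h v := by
  induction h with
  | refl => simpa [trans_self] using hv
  | step h ih =>
    rw [S.trans_succ h]
    exact S.step_nonneg _ ih

instance : DirectedSystem S.Level (S.trans · · ·) where
  map_self i x := by simp [trans_self]
  map_map _ _ _ hij hjk x := S.trans_trans hij hjk x

/-- The direct limit of the sequence, as an abelian group. -/
def Limit : Type := DirectLimit S.Level S.trans

noncomputable instance : AddCommGroup S.Limit :=
  inferInstanceAs (AddCommGroup (DirectLimit S.Level S.trans))

/-- The class `[v, i]` of `v ∈ ℤ^{f i}` in the direct limit. -/
def cls (i : ℕ) (v : S.Level i) : S.Limit :=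
  (⟦⟨i, v⟩⟧ : DirectLimit S.Level S.trans)

theorem cls_add (i : ℕ) (v w : S.Level i) : S.cls i (v + w) = S.cls i v + S.cls i w :=
  (DirectLimit.add_def (f := S.trans) i v w).symm

theorem cls_neg (i : ℕ) (v : S.Level i) : S.cls i (-v) = -S.cls i v := rfl

theorem cls_zero (i : ℕ) : S.cls i 0 = 0 :=
  (DirectLimit.zero_def (f := S.trans) i).symm

theorem cls_trans {i j : ℕ} (h : i ≤ j) (v : S.Level i) : S.cls j (S.trans i j h v) = S.cls i v :=
  DirectLimit.mk_apply (f := S.trans) i j v h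

theorem cls_eq_zero {i : ℕ} {v : S.Level i} (h : S.cls i v = 0) :
    ∃ j, ∃ hij : i ≤ j, S.trans i j hij v = 0 :=
  (DirectLimit.exists_eq_zero (f := S.trans) ⟨i, v⟩).1 h

/-- The positive cone of the direct limit: classes of coordinatewise nonnegative vectors. -/
def Pos (x : S.Limit) : Prop := ∃ (i : ℕ) (v : S.Level i), 0 ≤ v ∧ x = S.cls i v

theorem Pos.add {S : SimplicialSequence} {x y : S.Limit} (hx : S.Pos x) (hy : S.Pos y) :
    S.Pos (x + y) := by
  obtain ⟨i, v, hv, rfl⟩ := hx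
  obtain ⟨j, w, hw, rfl⟩ := hy
  refine ⟨max i j, S.trans i _ (le_max_left i j) v + S.trans j _ (le_max_right i j) w,
    add_nonneg (S.trans_nonneg _ hv) (S.trans_nonneg _ hw), ?_⟩
  rw [cls_add, cls_trans, cls_trans]

theorem Pos.eq_zero {S : SimplicialSequence} {x : S.Limit} (hx : S.Pos x) (hy : S.Pos (-x)) :
    x = 0 := by
  obtain ⟨i, v, hv, rfl⟩ := hx
  obtain ⟨j, w, hw, h⟩ := hy
  have h0 : S.cls (max i j)
      (S.trans i _ (le_max_left i j) v + S.trans j _ (le_max_right i j) w) = 0 := by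
    rw [cls_add, cls_trans, cls_trans, ← h, add_neg_cancel]
  obtain ⟨k, hk, h1⟩ := S.cls_eq_zero h0
  rw [map_add, trans_trans, trans_trans] at h1
  have h2 := (add_eq_zero_iff_of_nonneg (S.trans_nonneg _ hv) (S.trans_nonneg _ hw)).1 h1
  rw [← S.cls_trans ((le_max_left i j).trans hk) v, h2.1, cls_zero]

/-- The direct limit order: `x ≤ y` iff `y - x` is the class of a nonnegative vector. -/
instance : PartialOrder S.Limit where
  le x y := S.Pos (y - x)
  le_refl x := ⟨0, 0, le_rfl, by rw [sub_self, cls_zero]⟩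
  le_trans x y z hxy hyz := by simpa using hyz.add hxy
  le_antisymm x y hxy hyx := by
    have := hxy.eq_zero (by simpa using hyx)
    exact (sub_eq_zero.1 this).symm

theorem le_iff {x y : S.Limit} : x ≤ y ↔ S.Pos (y - x) := Iff.rfl

instance : IsOrderedAddMonoid S.Limit where
  add_le_add_left x y h z := by
    rw [le_iff] at h ⊢
    simpa using h

end SimplicialSequence

/-- A sequence of simplicial groups in which, for each `i`, all column sums of the `i`-th matrix
are equal to one and the same positive integer `colSum i`. -/
structure ECSSequence extends SimplicialSequence where
  colSum : ℕ → ℕ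
  colSum_pos : ∀ i, 0 < colSum i
  sum_col : ∀ (i : ℕ) (j : Fin (size i)), ∑ r, mat i r j = colSum i

namespace ECSSequence

variable (E : ECSSequence)

/-- The normalized constant row at level `j`: `v ↦ (∑ₖ v_k) / ∏_{i < j} c_i`. -/
noncomputable def levelTrace (j : ℕ) : E.Level j →+ ℝ where
  toFun v := ((∑ k, v k : ℤ) : ℝ) / ∏ i ∈ Finset.range j, (E.colSum i : ℝ)
  map_zero' := by simp
  map_add' v w := by
    simp only [Pi.add_apply, Finset.sum_add_distrib, Int.cast_add, add_div]

theorem sum_step (j : ℕ) (v : E.Level j) : ∑ r, E.step j v r = E.colSum j * ∑ k, v k := by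
  simp only [SimplicialSequence.step, LinearMap.toAddMonoidHom_coe, Matrix.mulVecLin_apply,
    Matrix.mulVec, dotProduct, Matrix.map_apply]
  rw [Finset.sum_comm, Finset.mul_sum]
  refine Finset.sum_congr rfl fun k _ => ?_
  rw [← Finset.sum_mul, ← E.sum_col j k, Nat.cast_sum]

theorem levelTrace_step (j : ℕ) (v : E.Level j) :
    E.levelTrace (j + 1) (E.step j v) = E.levelTrace j v := by
  have h : (E.colSum j : ℝ) ≠ 0 := by exact_mod_cast (E.colSum_pos j).ne'
  simp only [levelTrace, AddMonoidHom.coe_mk, ZeroHom.coe_mk, E.sum_step, Finset.prod_range_succ]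
  push_cast
  rw [mul_comm (∏ i ∈ Finset.range j, (E.colSum i : ℝ)), mul_div_mul_left _ _ h]

theorem levelTrace_trans {i j : ℕ} (h : i ≤ j) (v : E.Level i) :
    E.levelTrace i v = E.levelTrace j (E.trans i j h v) := by
  induction h with
  | refl => simp [SimplicialSequence.trans_self]
  | step h ih =>
    rw [E.trans_succ h, AddMonoidHom.comp_apply, levelTrace_step, ih]

/-- The trace associated to the sequence: `[v, j] ↦ (∑ₖ v_k) / ∏_{i < j} c_i`. -/
noncomputable def trace : E.Limit →+ ℝ where
  toFun x := DirectLimit.lift E.trans (fun i v => E.levelTrace i v)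
    (fun _ _ h v => E.levelTrace_trans h v) x
  map_zero' := DirectLimit.lift_zero (f := E.trans) E.levelTrace
    (fun _ _ h v => E.levelTrace_trans h v)
  map_add' x y := DirectLimit.lift_add (f := E.trans) E.levelTrace
    (fun _ _ h v => E.levelTrace_trans h v) x y

theorem trace_cls (j : ℕ) (v : E.Level j) :
    E.trace (E.cls j v) = ((∑ k, v k : ℤ) : ℝ) / ∏ i ∈ Finset.range j, (E.colSum i : ℝ) := rfl

end ECSSequence

/-- An ECS realization of the ordered group `G`: an isomorphism of ordered groups from `G` onto
the direct limit of a sequence of simplicial groups by matrices with equal column sums. -/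
structure ECSRealization (G : Type*) [AddCommGroup G] [PartialOrder G] where
  seq : ECSSequence
  iso : G ≃+o seq.Limit

/-- The trace on `G` associated to an ECS realization of `G`. -/
noncomputable def ECSRealization.trace {G : Type*} [AddCommGroup G] [PartialOrder G]
    (R : ECSRealization G) : G →+ ℝ :=
  R.seq.trace.comp R.iso.toAddEquiv.toAddMonoidHom

/-!
The key fact, due to Shen, is that a positive homomorphism `f : ℤⁿ → G` into a dimension group
factors through a positive homomorphism `ℤⁿ → ℤᵐ` which vanishes on `ker f`. Let `e_k` be the basis
vectors. Given a relation `f v = 0` with a coefficient `v i₀ > 0` of largest absolute value,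
unperforation bounds `f e_{i₀}` by the sum of the `f e_k` with `v k < 0`, and Riesz decomposition
splits it accordingly; after rewriting `f` in terms of the parts, `v i₀` is traded for strictly
smaller coefficients, so the multiset of absolute values decreases in the Dershowitz–Manna order.

If `t` is faithful, good and rational-valued, the traces of the `f e_k` are multiples of a common
`h ∈ t(G)`, `h > 0`. Goodness splits each `f e_k` into pieces of trace `h`, with no remainder since
`t` is faithful. Hence `f` factors further through a homomorphism all of whose basis vectors have
the same trace, and such homomorphisms are related by matrices with equal column sums. Doing this
repeatedly while adjoining the positive elements of a countable `G` one at a time presents `G` as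
the required limit.

Conversely, in a limit with equal column sums an element below `b` of prescribed trace is found at
a finite level, where it amounts to Riesz decomposition in `ℤ`.
-/

universe u

section DimensionGroup

variable {G : Type*} [AddCommGroup G] [PartialOrder G] [IsOrderedAddMonoid G]

theorem isDimensionGroup_of_linearOrder {A : Type*} [AddCommGroup A] [LinearOrder A]
    [IsOrderedAddMonoid A] : IsDimensionGroup A where
  directed g := ⟨g⁺, g⁻, posPart_nonneg g, negPart_nonneg g, (posPart_sub_negPart g).symm⟩
  unperforated _ _ hn hg := (nsmul_nonneg_iff hn.ne').1 hg
  interpolation a₁ a₂ _ _ h₁₁ h₁₂ h₂₁ h₂₂ :=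
    ⟨max a₁ a₂, le_max_left _ _, le_max_right _ _, max_le h₁₁ h₂₁, max_le h₁₂ h₂₂⟩

theorem IsDimensionGroup.riesz_decomposition (hG : IsDimensionGroup G) {ι : Type*}
    (s : Finset ι) {x : ι → G} (hx : 0 ≤ x) {a : G} (ha : 0 ≤ a) (hle : a ≤ ∑ i ∈ s, x i) :
    ∃ y ∈ Set.Icc 0 x, ∑ i ∈ s, y i = a := by
  classical
  induction s using Finset.induction_on generalizing a with
  | empty => exact ⟨0, ⟨le_rfl, hx⟩, ha.antisymm (by simpa using hle)⟩
  | insert j s hj ih =>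
    rw [Finset.sum_insert hj] at hle
    obtain ⟨c, h0c, hsc, hca, hcx⟩ := hG.interpolation 0 (a - ∑ i ∈ s, x i) a (x j) ha (hx j)
      (sub_le_self a (Finset.sum_nonneg fun i _ => hx i)) (sub_le_iff_le_add.2 hle)
    obtain ⟨y, ⟨hy0, hyx⟩, hy⟩ := ih (sub_nonneg.2 hca) (sub_le_comm.1 hsc)
    refine ⟨Function.update y j c, ⟨?_, ?_⟩, ?_⟩
    · exact le_update_iff.2 ⟨h0c, fun i _ => hy0 i⟩
    · exact update_le_iff.2 ⟨hcx, fun i _ => hyx i⟩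
    · rw [Finset.sum_insert hj, Function.update_self, Finset.sum_update_of_notMem hj, hy,
        add_sub_cancel]

theorem IsDimensionGroup.le_of_nsmul_le_nsmul (hG : IsDimensionGroup G) {n : ℕ} (hn : 0 < n)
    {a b : G} (h : n • a ≤ n • b) : a ≤ b :=
  sub_nonneg.1 (hG.unperforated n _ hn (by rwa [smul_sub, sub_nonneg]))

end DimensionGroup

section PositiveHom

variable {ι G : Type*} [AddCommGroup G]

theorem map_eq_sum_zsmul_single [Fintype ι] [DecidableEq ι] {F : Type*} [FunLike F (ι → ℤ) G]
    [AddMonoidHomClass F (ι → ℤ) G] (f : F) (v : ι → ℤ) :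
    f v = ∑ i, v i • f (Pi.single i 1) := by
  conv_lhs => rw [← Finset.univ_sum_single v, map_sum]
  refine Finset.sum_congr rfl fun i _ => ?_
  rw [← map_zsmul, ← Pi.single_smul, smul_eq_mul, mul_one]

variable [PartialOrder G]

theorem map_single_one_nonneg [DecidableEq ι] (f : (ι → ℤ) →+o G) (i : ι) :
    0 ≤ f (Pi.single i 1) :=
  map_nonneg f (Pi.single_nonneg.2 zero_le_one)

theorem exists_map_single_ne_zero [Finite ι] [DecidableEq ι] {f : (ι → ℤ) →+o G} (hf : f ≠ 0) :
    ∃ i, f (Pi.single i 1) ≠ 0 := by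
  cases nonempty_fintype ι
  contrapose! hf
  ext v
  rw [map_eq_sum_zsmul_single f, Finset.sum_eq_zero fun i _ => by rw [hf, smul_zero]]
  rfl

variable [Fintype ι] [IsOrderedAddMonoid G]

/-- The positive homomorphism `ℤ^ι → G` taking the standard basis to a given family `x` of positive
elements. -/
def positiveHom (x : ι → G) (hx : 0 ≤ x) : (ι → ℤ) →+o G where
  __ := (Fintype.linearCombination ℤ x).toAddMonoidHom
  monotone' _ _ hvw := Finset.sum_le_sum fun i _ => zsmul_le_zsmul_left (hx i) (hvw i)

theorem positiveHom_apply {x : ι → G} (hx : 0 ≤ x) (v : ι → ℤ) :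
    positiveHom x hx v = ∑ i, v i • x i := rfl

theorem positiveHom_single [DecidableEq ι] {x : ι → G} (hx : 0 ≤ x) (i : ι) :
    positiveHom x hx (Pi.single i 1) = x i := by
  rw [positiveHom_apply, Fintype.sum_eq_single i fun j hj => by simp [hj], Pi.single_eq_same,
    one_smul]

end PositiveHom

section Shen

variable {ι : Type u} {G : Type*} [AddCommGroup G] [PartialOrder G]

/-- The positive homomorphism `f` factors through a positive homomorphism into some `ℤ^κ` which
vanishes on `s`. -/
def FactorsKilling (f : (ι → ℤ) →+o G) (s : Set (ι → ℤ)) : Prop :=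
  ∃ (κ : Type u) (_ : Finite κ) (φ : (ι → ℤ) →+o (κ → ℤ)) (g : (κ → ℤ) →+o G),
    g.comp φ = f ∧ ∀ v ∈ s, φ v = 0

/-- Shen's substitution at `i₀`: the `inl` coefficients are those of `v` away from `i₀`, and the
`inr` coefficients are the sums `v i₀ + v k` for `k ∈ J`. It expresses the basis vectors of `ℤ^ι`
after the `i₀`-th one has been written as a sum of parts, one below each `k`-th one with `k ∈ J`. -/
noncomputable def shenHom [DecidableEq ι] (i₀ : ι) (J : Set ι) : (ι → ℤ) →+o (ι ⊕ ι → ℤ) where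
  toFun v := Sum.elim (Function.update v i₀ 0) (J.indicator (v + fun _ => v i₀))
  map_zero' := by simp [← Pi.zero_def]
  map_add' v w := by
    have hadd : v + w + (fun _ => (v + w) i₀) = (v + fun _ => v i₀) + (w + fun _ => w i₀) :=
      add_add_add_comm v w (fun _ => v i₀) fun _ => w i₀
    rw [hadd, Set.indicator_add', ← Sum.elim_add_add, ← Function.update_add, zero_add]
  monotone' v w hvw := by
    rintro (k | k)
    · by_cases hk : k = i₀
      · simp [hk]
      · simpa [hk] using hvw k
    · by_cases hk : k ∈ J
      · simpa [hk] using add_le_add (hvw k) (hvw i₀)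
      · simp [hk]

theorem shenHom_apply [DecidableEq ι] (i₀ : ι) (J : Set ι) (v : ι → ℤ) :
    shenHom i₀ J v = Sum.elim (Function.update v i₀ 0) (J.indicator (v + fun _ => v i₀)) := rfl

theorem map_single_le_map_indicator [DecidableEq ι] [IsOrderedAddMonoid G]
    (hG : IsDimensionGroup G) (f : (ι → ℤ) →+o G) {v : ι → ℤ} (hv : f v = 0) {i₀ : ι}
    (hpos : 0 < v i₀) (hmax : ∀ i, -v i₀ ≤ v i) :
    f (Pi.single i₀ 1) ≤ f ({i | v i < 0}.indicator 1) := by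
  have hbound : v i₀ • Pi.single i₀ 1 ≤ v + v i₀ • {i | v i < 0}.indicator (1 : ι → ℤ) := by
    intro k
    have hk := hmax k
    by_cases hki : k = i₀
    · subst hki
      simp [hpos.le]
    · by_cases hvk : v k < 0 <;> simp [hki, hvk] <;> omega
  refine hG.le_of_nsmul_le_nsmul (n := (v i₀).toNat) (by omega) ?_
  rw [← natCast_zsmul, ← natCast_zsmul, Int.toNat_of_nonneg hpos.le]
  simpa only [map_add, map_zsmul, hv, zero_add] using OrderHomClass.mono f hbound

section CoeffSizes

variable [Fintype ι]

/-- The absolute values of the coefficients of `v`, with multiplicity. -/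
def coeffSizes (v : ι → ℤ) : Multiset ℕ := Finset.univ.val.map fun i => (v i).natAbs

theorem coeffSizes_neg (v : ι → ℤ) : coeffSizes (-v) = coeffSizes v := by
  simp only [coeffSizes, Pi.neg_apply, Int.natAbs_neg]

theorem coeffSizes_comp_inl_add_inr {κ : Type*} [Fintype κ] (v : ι ⊕ κ → ℤ) :
    coeffSizes v = coeffSizes (v ∘ Sum.inl) + coeffSizes (v ∘ Sum.inr) :=
  Multiset.map_disjSum _

theorem coeffSizes_update [DecidableEq ι] (v : ι → ℤ) (i : ι) (m : ℤ) :
    coeffSizes (Function.update v i m) =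
      m.natAbs ::ₘ (Finset.univ.erase i).val.map fun j => (v j).natAbs := by
  rw [coeffSizes, ← Finset.insert_erase (Finset.mem_univ i),
    Finset.insert_val_of_notMem (Finset.notMem_erase i _), Multiset.map_cons,
    Function.update_self, Finset.erase_insert (Finset.notMem_erase i _)]
  congr 1
  refine Multiset.map_congr rfl fun j hj => ?_
  rw [Function.update_of_ne (Finset.ne_of_mem_erase hj)]

theorem coeffSizes_shenHom_lt [DecidableEq ι] {v : ι → ℤ} {i₀ : ι} (hpos : 0 < v i₀)
    (hmax : ∀ i, -v i₀ ≤ v i) :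
    (coeffSizes (shenHom i₀ {i | v i < 0} v)).IsDershowitzMannaLT (coeffSizes v) := by
  refine ⟨(Finset.univ.erase i₀).val.map fun j => (v j).natAbs,
    0 ::ₘ coeffSizes ({i | v i < 0}.indicator (v + fun _ => v i₀)), {(v i₀).natAbs},
    Multiset.singleton_ne_zero _, ?_, ?_, ?_⟩
  · rw [shenHom_apply, coeffSizes_comp_inl_add_inr, Sum.elim_comp_inl, Sum.elim_comp_inr,
      coeffSizes_update, Int.natAbs_zero, Multiset.cons_add, Multiset.add_cons]
  · rw [← Function.update_eq_self i₀ v, coeffSizes_update, Function.update_eq_self, add_comm,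
      Multiset.singleton_add]
  · simp only [coeffSizes, Multiset.mem_cons, Multiset.mem_map, Multiset.mem_singleton,
      exists_eq_left]
    rintro _ (rfl | ⟨k, -, rfl⟩)
    · omega
    · by_cases hk : v k < 0
      · rw [Set.indicator_of_mem (show k ∈ {i | v i < 0} from hk), Pi.add_apply]
        have := hmax k
        omega
      · rw [Set.indicator_of_notMem (show k ∉ {i | v i < 0} from hk)]
        omega

end CoeffSizes

variable [IsOrderedAddMonoid G]

theorem exists_comp_shenHom_eq [Finite ι] [DecidableEq ι] (hG : IsDimensionGroup G)
    (f : (ι → ℤ) →+o G) {i₀ : ι} {J : Set ι} (hi₀ : i₀ ∉ J)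
    (hle : f (Pi.single i₀ 1) ≤ f (J.indicator 1)) :
    ∃ g : (ι ⊕ ι → ℤ) →+o G, g.comp (shenHom i₀ J) = f := by
  cases nonempty_fintype ι
  set x : ι → G := fun i => f (Pi.single i 1)
  have hx : 0 ≤ x := map_single_one_nonneg f
  have hsum : f (J.indicator 1) = ∑ i, J.indicator x i := by
    rw [map_eq_sum_zsmul_single f]
    refine Finset.sum_congr rfl fun i _ => ?_
    by_cases hi : i ∈ J <;> simp [hi, x]
  obtain ⟨y, ⟨hy0, hyx⟩, hy⟩ := hG.riesz_decomposition Finset.univ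
    (Set.indicator_nonneg fun i _ => hx i) (hx i₀) (hle.trans_eq hsum)
  have hyJ : ∀ k ∉ J, y k = 0 := fun k hk =>
    ((hyx k).trans_eq (Set.indicator_of_notMem hk x)).antisymm (hy0 k)
  have hz : 0 ≤ x - y := sub_nonneg.2 (hyx.trans (Set.indicator_le_self' fun i _ => hx i))
  refine ⟨positiveHom (Sum.elim (x - y) y) (Sum.rec hz hy0), ?_⟩
  ext v
  have hterm (k : ι) : Function.update v i₀ 0 k • (x - y) k +
      J.indicator (v + fun _ => v i₀) k • y k =
        v k • x k + (v i₀ • y k - Pi.single (M := fun _ => G) i₀ (v i₀ • x i₀) k) := by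
    by_cases hkJ : k ∈ J
    · have hki : k ≠ i₀ := fun h => hi₀ (h ▸ hkJ)
      simp [hkJ, hki, smul_sub, add_smul, ← add_assoc]
    · by_cases hki : k = i₀
      · subst hki
        simp [hyJ k hkJ]
      · simp [hkJ, hki, hyJ k hkJ]
  calc positiveHom (Sum.elim (x - y) y) (Sum.rec hz hy0) (shenHom i₀ J v)
    _ = ∑ k, (v k • x k + (v i₀ • y k - Pi.single (M := fun _ => G) i₀ (v i₀ • x i₀) k)) := by
      simp only [positiveHom_apply, Fintype.sum_sum_type, shenHom_apply, Sum.elim_inl,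
        Sum.elim_inr, ← Finset.sum_add_distrib, hterm]
    _ = ∑ k, v k • x k := by
      rw [Finset.sum_add_distrib, Finset.sum_sub_distrib, ← Finset.smul_sum, hy,
        Finset.sum_pi_single', if_pos (Finset.mem_univ i₀), sub_self, add_zero]
    _ = f v := (map_eq_sum_zsmul_single f v).symm

theorem exists_comp_eq_coeffSizes_lt [Fintype ι] (hG : IsDimensionGroup G)
    (f : (ι → ℤ) →+o G) {v : ι → ℤ} (hv : f v = 0) (hv0 : v ≠ 0) :
    ∃ (φ : (ι → ℤ) →+o (ι ⊕ ι → ℤ)) (g : (ι ⊕ ι → ℤ) →+o G),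
      g.comp φ = f ∧ (coeffSizes (φ v)).IsDershowitzMannaLT (coeffSizes v) := by
  classical
  obtain ⟨k, hk⟩ := Function.ne_iff.1 hv0
  obtain ⟨i₀, -, hmax⟩ :=
    Finset.exists_max_image Finset.univ (fun i => |v i|) ⟨k, Finset.mem_univ k⟩
  wlog hpos : 0 < v i₀ generalizing v
  · obtain ⟨φ, g, hg, hlt⟩ := this (v := -v) (by rw [map_neg, hv, neg_zero]) (neg_ne_zero.2 hv0)
      (by simpa using hk) (by simpa using hmax) (by
        have := (abs_pos.2 hk).trans_le (hmax k (Finset.mem_univ k))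
        simpa using lt_of_le_of_ne (not_lt.1 hpos) (abs_pos.1 this))
    exact ⟨φ, g, hg, by rwa [map_neg, coeffSizes_neg, coeffSizes_neg] at hlt⟩
  have hmax' (i : ι) : -v i₀ ≤ v i :=
    neg_le_of_abs_le ((hmax i (Finset.mem_univ i)).trans_eq (abs_of_pos hpos))
  obtain ⟨g, hg⟩ := exists_comp_shenHom_eq hG f (J := {i | v i < 0}) (not_lt.2 hpos.le)
    (map_single_le_map_indicator hG f hv hpos hmax')
  exact ⟨_, g, hg, coeffSizes_shenHom_lt hpos hmax'⟩

theorem factorsKilling_singleton {ι : Type u} [Finite ι] (hG : IsDimensionGroup G)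
    (f : (ι → ℤ) →+o G) {v : ι → ℤ} (hv : f v = 0) : FactorsKilling f {v} := by
  cases nonempty_fintype ι
  rcases eq_or_ne v 0 with rfl | hv0
  · exact ⟨ι, ‹_›, .id _, f, f.comp_id, fun _ h => h⟩
  · obtain ⟨φ, g, rfl, hlt⟩ := exists_comp_eq_coeffSizes_lt hG f hv hv0
    obtain ⟨κ, hκ, ψ, h, rfl, hψ⟩ := factorsKilling_singleton hG g (v := φ v) hv
    exact ⟨κ, hκ, ψ.comp φ, h, rfl, by rintro _ rfl; exact hψ _ rfl⟩
termination_by @coeffSizes ι (Fintype.ofFinite ι) v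
decreasing_by convert hlt

variable [Finite ι]

theorem factorsKilling_finset (hG : IsDimensionGroup G) (f : (ι → ℤ) →+o G)
    (s : Finset (ι → ℤ)) (hs : ∀ v ∈ s, f v = 0) : FactorsKilling f (s : Set (ι → ℤ)) := by
  classical
  induction s using Finset.induction_on with
  | empty => exact ⟨ι, ‹_›, .id _, f, f.comp_id, by simp⟩
  | insert w s _ ih =>
    obtain ⟨κ, _, φ, g, rfl, hφ⟩ := ih fun v hv => hs v (Finset.mem_insert_of_mem hv)
    obtain ⟨μ, hμ, ψ, h, rfl, hψ⟩ :=
      factorsKilling_singleton hG g (hs w (Finset.mem_insert_self w s))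
    refine ⟨μ, hμ, ψ.comp φ, h, rfl, fun v hv => ?_⟩
    rcases Finset.mem_insert.1 hv with rfl | hv
    · exact hψ _ rfl
    · rw [OrderAddMonoidHom.comp_apply, hφ v hv, map_zero]

theorem factorsKilling_ker (hG : IsDimensionGroup G) (f : (ι → ℤ) →+o G) :
    FactorsKilling f {v | f v = 0} := by
  obtain ⟨s, hs⟩ := (Submodule.fg_iff_addSubgroup_fg _).1
    (IsNoetherian.noetherian (f : (ι → ℤ) →+ G).toIntLinearMap.ker)
  have hs' (v : ι → ℤ) : v ∈ AddSubgroup.closure (s : Set (ι → ℤ)) ↔ f v = 0 := by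
    rw [hs]; exact LinearMap.mem_ker
  obtain ⟨κ, hκ, φ, g, hg, hφ⟩ := factorsKilling_finset hG f s fun v hv =>
    (hs' v).1 (AddSubgroup.subset_closure hv)
  have hle : AddSubgroup.closure (s : Set (ι → ℤ)) ≤ (φ : (ι → ℤ) →+ κ → ℤ).ker :=
    (AddSubgroup.closure_le _).2 hφ
  exact ⟨κ, hκ, φ, g, hg, fun v hv => hle ((hs' v).2 hv)⟩

end Shen

section GoodTrace

variable {ι G : Type*} [AddCommGroup G] {t : G →+ ℝ}

theorem IsRationalTrace.exists_range_eq_zmultiples [Finite ι] {t : (ι → ℤ) →+ ℝ}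
    (ht : IsRationalTrace t) : ∃ h, 0 ≤ h ∧ t.range = AddSubgroup.zmultiples h := by
  classical
  cases nonempty_fintype ι
  choose r hr using fun i => ht (Pi.single i 1)
  let D : ℕ := ∏ i, (r i).den
  have hr_mem (i : ι) : (r i : ℝ) ∈ AddSubgroup.zmultiples (D : ℝ)⁻¹ := by
    obtain ⟨k, hk⟩ : (r i).den ∣ D := Finset.dvd_prod_of_mem _ (Finset.mem_univ i)
    have hD0 : (r i).den * k ≠ 0 := hk ▸ Finset.prod_ne_zero_iff.2 fun i _ => (r i).den_ne_zero
    have hk0 : (k : ℝ) ≠ 0 := Nat.cast_ne_zero.2 (right_ne_zero_of_mul hD0)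
    refine ⟨(r i).num * k, ?_⟩
    rw [hk, Rat.cast_def]
    simp only [zsmul_eq_mul]
    push_cast
    field_simp
  obtain ⟨n, hn⟩ := (AddSubgroup.le_zmultiples_iff (D : ℝ)⁻¹ t.range).1 <| by
    rintro _ ⟨v, rfl⟩
    rw [map_eq_sum_zsmul_single t v]
    exact sum_mem fun i _ => zsmul_mem (hr i ▸ hr_mem i) _
  exact ⟨n • (D : ℝ)⁻¹, by positivity, hn⟩

variable [PartialOrder G] [IsOrderedAddMonoid G]

theorem IsGoodTrace.exists_sum_eq (hg : IsGoodTrace t) (hf : IsFaithfulTrace t) {h : ℝ}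
    (hr : h ∈ Set.range t) (h0 : 0 ≤ h) {n : ℕ} {x : G} (hx : 0 ≤ x) (hn : t x = n * h) :
    ∃ y : Fin n → G, 0 ≤ y ∧ (∀ i, t (y i) = h) ∧ ∑ i, y i = x := by
  induction n generalizing x with
  | zero =>
    exact ⟨0, le_rfl, fun i => i.elim0, (hf x hx (by simpa using hn)).symm⟩
  | succ n ih =>
    rw [Nat.cast_succ, add_one_mul] at hn
    obtain ⟨y, ⟨hy0, hyx⟩, hty⟩ : h ∈ t '' Set.Icc 0 x :=
      (hg x hx).ge ⟨hr, h0, by rw [hn]; exact le_add_of_nonneg_left (by positivity)⟩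
    obtain ⟨z, hz0, htz, hz⟩ := ih (sub_nonneg.2 hyx) <| by
      rw [map_sub, hn, hty, add_sub_cancel_right]
    refine ⟨Fin.cons y z, Fin.cases hy0 hz0, Fin.cases hty htz, ?_⟩
    rw [Fin.sum_cons, hz, add_sub_cancel]

end GoodTrace

section EqualTraceLevel

variable {G : Type*} [AddCommGroup G] [PartialOrder G] {t : G →+ ℝ}

/-- A positive homomorphism `ℤ^size → G`, `0 < size`, sending all the standard basis vectors to
elements of the same trace `val`. These are the levels of an equal column sum realization of `G`. -/
structure EqualTraceLevel (t : G →+ ℝ) where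
  size : ℕ
  size_pos : 0 < size
  toHom : (Fin size → ℤ) →+o G
  val : ℝ
  val_pos : 0 < val
  trace_toHom : ∀ v, t (toHom v) = val * (∑ k, v k : ℤ)

theorem EqualTraceLevel.toHom_ne_zero (F : EqualTraceLevel t) : F.toHom ≠ 0 := by
  intro h
  have htr := F.trace_toHom (Pi.single ⟨0, F.size_pos⟩ 1)
  rw [h, Finset.sum_pi_single'] at htr
  simp [F.val_pos.ne] at htr

theorem exists_pos_forall_trace_eq_natCast_mul (ht : ∀ g, 0 ≤ g → 0 ≤ t g)
    (hq : IsRationalTrace t) (hf : IsFaithfulTrace t) {ι : Type*} [Finite ι]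
    {f : (ι → ℤ) →+o G} (hf0 : f ≠ 0) :
    ∃ h ∈ Set.range t, 0 < h ∧ ∀ v, 0 ≤ f v → ∃ n : ℕ, t (f v) = n * h := by
  classical
  obtain ⟨h, h_nonneg, hrange⟩ :=
    IsRationalTrace.exists_range_eq_zmultiples (t := t.comp (f : (ι → ℤ) →+ G)) fun v => hq (f v)
  have hmul (v : ι → ℤ) : ∃ m : ℤ, m • h = t (f v) :=
    (hrange ▸ ⟨v, rfl⟩ : t (f v) ∈ AddSubgroup.zmultiples h)
  have h_pos : 0 < h := by
    refine h_nonneg.lt_of_ne' ?_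
    rintro rfl
    obtain ⟨i, hi⟩ := exists_map_single_ne_zero hf0
    obtain ⟨m, hm⟩ := hmul (Pi.single i 1)
    exact hi (hf _ (map_single_one_nonneg f i) (by rw [← hm, smul_zero]))
  obtain ⟨v, hv⟩ := hrange.ge (AddSubgroup.mem_zmultiples h)
  refine ⟨h, ⟨f v, hv⟩, h_pos, fun w hw => ?_⟩
  obtain ⟨m, hm⟩ := hmul w
  obtain ⟨n, rfl⟩ := Int.eq_ofNat_of_zero_le <|
    nonneg_of_smul_nonneg_of_pos_right (hm.ge.trans' (ht _ hw)) h_pos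
  exact ⟨n, by rw [← hm, natCast_zsmul, nsmul_eq_mul]⟩

variable [IsOrderedAddMonoid G]

/-- The level spanned by a finite nonempty family of positive elements of the same trace. -/
noncomputable def EqualTraceLevel.ofFamily {κ : Type*} [Fintype κ] [Nonempty κ] {y : κ → G}
    (hy : 0 ≤ y) {h : ℝ} (h0 : 0 < h) (hty : ∀ k, t (y k) = h) : EqualTraceLevel t where
  size := Fintype.card κ
  size_pos := Fintype.card_pos
  toHom := positiveHom (y ∘ (Fintype.equivFin κ).symm) fun _ => hy _
  val := h
  val_pos := h0
  trace_toHom v := by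
    simp only [positiveHom_apply, map_sum, map_zsmul, Function.comp_apply, hty, zsmul_eq_mul,
      Int.cast_sum, ← Finset.sum_mul, mul_comm h]

/-- The pullback of integer vectors along a map of index types. -/
def reindexHom {ι κ : Type*} (s : κ → ι) : (ι → ℤ) →+o (κ → ℤ) where
  toFun v := v ∘ s
  map_zero' := rfl
  map_add' _ _ := rfl
  monotone' _ _ hvw k := hvw (s k)

theorem EqualTraceLevel.exists_toHom_comp_eq (ht : ∀ g, 0 ≤ g → 0 ≤ t g) (hq : IsRationalTrace t)
    (hf : IsFaithfulTrace t) (hg : IsGoodTrace t) {ι : Type*} [Finite ι] {f : (ι → ℤ) →+o G}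
    (hf0 : f ≠ 0) :
    ∃ (F : EqualTraceLevel t) (φ : (ι → ℤ) →+o (Fin F.size → ℤ)), F.toHom.comp φ = f := by
  classical
  cases nonempty_fintype ι
  obtain ⟨h, h_mem, h_pos, hmul⟩ := exists_pos_forall_trace_eq_natCast_mul ht hq hf hf0
  choose n hn using fun i => hmul _ (map_single_one_nonneg f i)
  choose y hy0 hty hy using fun i =>
    hg.exists_sum_eq hf h_mem h_pos.le (map_single_one_nonneg f i) (hn i)
  have : Nonempty (Σ i, Fin (n i)) := by
    obtain ⟨i, hi⟩ := exists_map_single_ne_zero hf0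
    refine ⟨i, 0, Nat.pos_of_ne_zero fun h0 => hi ?_⟩
    exact hf _ (map_single_one_nonneg f i) (by rw [hn, h0, Nat.cast_zero, zero_mul])
  let e := Fintype.equivFin (Σ i, Fin (n i))
  refine ⟨.ofFamily (y := fun p : Σ i, Fin (n i) => y p.1 p.2) (fun p => hy0 p.1 p.2) h_pos
    (fun p => hty p.1 p.2), reindexHom fun k => (e.symm k).1, ?_⟩
  ext v
  calc ∑ k, v (e.symm k).1 • y (e.symm k).1 (e.symm k).2
    _ = ∑ p : Σ i, Fin (n i), v p.1 • y p.1 p.2 := e.symm.sum_comp fun p => v p.1 • y p.1 p.2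
    _ = ∑ i, v i • f (Pi.single i 1) := by
      simp only [Fintype.sum_sigma, ← Finset.smul_sum, hy]
    _ = f v := (map_eq_sum_zsmul_single f v).symm

theorem exists_extension_by_element {ι : Type*} [Finite ι] (f : (ι → ℤ) →+o G) {a : G}
    (ha : 0 ≤ a) :
    ∃ (φ : (ι → ℤ) →+o (Option ι → ℤ)) (g : (Option ι → ℤ) →+o G),
      g.comp φ = f ∧ ∃ w, 0 ≤ w ∧ g w = a := by
  classical
  cases nonempty_fintype ι
  have hx : 0 ≤ fun o : Option ι => o.elim a fun i => f (Pi.single i 1) :=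
    Option.rec ha (map_single_one_nonneg f)
  have hsome : 0 ≤ fun i : ι => (Pi.single (some i) 1 : Option ι → ℤ) := fun i =>
    (Pi.single_nonneg.2 zero_le_one : (0 : Option ι → ℤ) ≤ Pi.single (some i) 1)
  refine ⟨positiveHom _ hsome, positiveHom _ hx, ?_, Pi.single none 1,
    Pi.single_nonneg.2 zero_le_one, positiveHom_single hx none⟩
  ext v
  simp only [OrderAddMonoidHom.comp_apply, positiveHom_apply hsome, map_sum, map_zsmul,
    positiveHom_single hx, Option.elim_some, ← map_eq_sum_zsmul_single f]

theorem EqualTraceLevel.exists_next (hG : IsDimensionGroup G) (ht : ∀ g, 0 ≤ g → 0 ≤ t g)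
    (hq : IsRationalTrace t) (hf : IsFaithfulTrace t) (hg : IsGoodTrace t) (F : EqualTraceLevel t)
    {a : G} (ha : 0 ≤ a) :
    ∃ (F' : EqualTraceLevel t) (φ : (Fin F.size → ℤ) →+o (Fin F'.size → ℤ)),
      F'.toHom.comp φ = F.toHom ∧ (∀ v, F.toHom v = 0 → φ v = 0) ∧
        ∃ w, 0 ≤ w ∧ F'.toHom w = a := by
  obtain ⟨ι, f, hFf, w, hw, rfl⟩ := exists_extension_by_element F.toHom ha
  obtain ⟨κ, _, φ, g, rfl, hφ⟩ := factorsKilling_ker hG f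
  have hg0 : g ≠ 0 := by
    rintro rfl
    exact F.toHom_ne_zero hFf.symm
  obtain ⟨F', ψ, rfl⟩ := exists_toHom_comp_eq ht hq hf hg hg0
  refine ⟨F', ψ.comp (φ.comp ι), hFf, fun v hv => ?_, ψ (φ w), ?_, rfl⟩
  · have hιv : φ (ι v) = 0 := hφ _ (by rw [← hv, ← hFf]; rfl)
    simp only [OrderAddMonoidHom.comp_apply, hιv, map_zero]
  · exact map_nonneg ψ (map_nonneg φ hw)

end EqualTraceLevel

namespace SimplicialSequence

variable (S : SimplicialSequence)

theorem exists_eq_cls (x : S.Limit) : ∃ i v, x = S.cls i v :=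
  DirectLimit.exists_eq_mk (f := S.trans) x

theorem cls_succ_step (i : ℕ) (v : S.Level i) : S.cls (i + 1) (S.step i v) = S.cls i v := by
  rw [← S.cls_trans (Nat.le_succ i), S.trans_succ le_rfl, trans_self]
  rfl

theorem nonneg_iff {x : S.Limit} : 0 ≤ x ↔ S.Pos x := by
  rw [le_iff, sub_zero]

theorem cls_le_cls {i : ℕ} {v w : S.Level i} (h : v ≤ w) : S.cls i v ≤ S.cls i w :=
  ⟨i, w - v, sub_nonneg.2 h, by rw [sub_eq_add_neg w, S.cls_add, S.cls_neg, sub_eq_add_neg]⟩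

theorem exists_common_level (x : S.Limit) {y : S.Limit} (hy : 0 ≤ y) :
    ∃ i v w, x = S.cls i v ∧ 0 ≤ w ∧ y = S.cls i w := by
  obtain ⟨i, v, rfl⟩ := S.exists_eq_cls x
  obtain ⟨j, w, hw, rfl⟩ := S.nonneg_iff.1 hy
  exact ⟨max i j, _, _, (S.cls_trans (le_max_left i j) v).symm,
    S.trans_nonneg (le_max_right i j) hw, (S.cls_trans (le_max_right i j) w).symm⟩

variable {G : Type*} [AddCommGroup G] [PartialOrder G] {S} {f : ∀ i, S.Level i →+o G}

theorem map_trans (hf : ∀ i v, f (i + 1) (S.step i v) = f i v) {i j : ℕ} (h : i ≤ j)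
    (v : S.Level i) : f j (S.trans i j h v) = f i v := by
  induction h with
  | refl => rw [trans_self, AddMonoidHom.id_apply]
  | step h ih => rw [S.trans_succ h, AddMonoidHom.comp_apply, hf, ih]

/-- The homomorphism from the limit induced by compatible positive homomorphisms `f i` from the
levels. -/
noncomputable def liftHom (hf : ∀ i v, f (i + 1) (S.step i v) = f i v) : S.Limit →+ G where
  toFun x := DirectLimit.lift S.trans (fun i v => f i v) (fun _ _ h v => (map_trans hf h v).symm) x
  map_zero' := DirectLimit.lift_zero (f := S.trans) f fun _ _ h v => (map_trans hf h v).symm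
  map_add' x y := DirectLimit.lift_add (f := S.trans) f (fun _ _ h v => (map_trans hf h v).symm) x y

theorem liftHom_cls (hf : ∀ i v, f (i + 1) (S.step i v) = f i v) (i : ℕ) (v : S.Level i) :
    liftHom hf (S.cls i v) = f i v := rfl

theorem liftHom_nonneg (hf : ∀ i v, f (i + 1) (S.step i v) = f i v) {x : S.Limit} (hx : 0 ≤ x) :
    0 ≤ liftHom hf x := by
  obtain ⟨i, v, hv, rfl⟩ := S.nonneg_iff.1 hx
  exact map_nonneg (f i) hv

theorem liftHom_injective (hf : ∀ i v, f (i + 1) (S.step i v) = f i v)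
    (hker : ∀ i v, f i v = 0 → S.step i v = 0) : Function.Injective (liftHom hf) := by
  refine (injective_iff_map_eq_zero _).2 fun x hx => ?_
  obtain ⟨i, v, rfl⟩ := S.exists_eq_cls x
  rw [← cls_succ_step, hker i v hx, cls_zero]

theorem exists_nonneg_liftHom_eq (hf : ∀ i v, f (i + 1) (S.step i v) = f i v)
    (hpos : ∀ a : G, 0 ≤ a → ∃ i v, 0 ≤ v ∧ f i v = a) {a : G} (ha : 0 ≤ a) :
    ∃ x, 0 ≤ x ∧ liftHom hf x = a := by
  obtain ⟨i, v, hv, rfl⟩ := hpos a ha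
  exact ⟨S.cls i v, S.nonneg_iff.2 ⟨i, v, hv, rfl⟩, rfl⟩

theorem exists_limit_orderAddMonoidIso [IsOrderedAddMonoid G]
    (hdir : ∀ g : G, ∃ a b : G, 0 ≤ a ∧ 0 ≤ b ∧ g = a - b)
    (hf : ∀ i v, f (i + 1) (S.step i v) = f i v) (hker : ∀ i v, f i v = 0 → S.step i v = 0)
    (hpos : ∀ a : G, 0 ≤ a → ∃ i v, 0 ≤ v ∧ f i v = a) :
    ∃ e : S.Limit ≃+o G, ∀ i v, e (S.cls i v) = f i v := by
  have hinj := liftHom_injective hf hker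
  have hsurj : Function.Surjective (liftHom hf) := fun g => by
    obtain ⟨a, b, ha, hb, rfl⟩ := hdir g
    obtain ⟨x, -, rfl⟩ := exists_nonneg_liftHom_eq hf hpos ha
    obtain ⟨y, -, rfl⟩ := exists_nonneg_liftHom_eq hf hpos hb
    exact ⟨x - y, map_sub _ _ _⟩
  have hle (x y : S.Limit) : liftHom hf x ≤ liftHom hf y ↔ x ≤ y := by
    rw [← sub_nonneg, ← map_sub, ← sub_nonneg (a := y)]
    refine ⟨fun h => ?_, liftHom_nonneg hf⟩
    obtain ⟨z, hz, hzx⟩ := exists_nonneg_liftHom_eq hf hpos h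
    rwa [← hinj hzx]
  exact ⟨{ AddEquiv.ofBijective (liftHom hf) ⟨hinj, hsurj⟩ with map_le_map_iff' := hle _ _ },
    liftHom_cls hf⟩

end SimplicialSequence

namespace ECSSequence

variable (E : ECSSequence)

theorem prod_colSum_pos (i : ℕ) : 0 < ∏ j ∈ Finset.range i, (E.colSum j : ℝ) :=
  Finset.prod_pos fun j _ => Nat.cast_pos.2 (E.colSum_pos j)

theorem trace_nonneg {x : E.Limit} (hx : 0 ≤ x) : 0 ≤ E.trace x := by
  obtain ⟨i, v, hv, rfl⟩ := E.nonneg_iff.1 hx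
  exact div_nonneg (Int.cast_nonneg (Finset.sum_nonneg fun k _ => hv k)) (E.prod_colSum_pos i).le

theorem isRationalTrace_trace : IsRationalTrace E.trace := fun x => by
  obtain ⟨i, v, rfl⟩ := E.exists_eq_cls x
  refine ⟨(∑ k, v k : ℤ) / ∏ j ∈ Finset.range i, (E.colSum j : ℚ), ?_⟩
  rw [E.trace_cls, Rat.cast_div, Rat.cast_intCast, Rat.cast_prod]
  simp only [Rat.cast_natCast]

theorem isFaithfulTrace_trace : IsFaithfulTrace E.trace := fun x hx h => by
  obtain ⟨i, v, hv, rfl⟩ := E.nonneg_iff.1 hx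
  rw [E.trace_cls, div_eq_zero_iff, or_iff_left (E.prod_colSum_pos i).ne', Int.cast_eq_zero,
    Fintype.sum_eq_zero_iff_of_nonneg hv] at h
  rw [h, E.cls_zero]

theorem isGoodTrace_trace : IsGoodTrace E.trace := by
  refine fun b hb => Set.Subset.antisymm ?_ ?_
  · rintro _ ⟨x, ⟨hx0, hxb⟩, rfl⟩
    refine ⟨⟨x, rfl⟩, E.trace_nonneg hx0, ?_⟩
    rw [← sub_nonneg, ← map_sub]
    exact E.trace_nonneg (sub_nonneg.2 hxb)
  · rintro _ ⟨⟨x, rfl⟩, h0, hle⟩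
    obtain ⟨i, w, v, rfl, hv, rfl⟩ := E.exists_common_level x hb
    rw [E.trace_cls, le_div_iff₀ (E.prod_colSum_pos i), zero_mul, Int.cast_nonneg_iff] at h0
    rw [E.trace_cls, E.trace_cls, div_le_div_iff_of_pos_right (E.prod_colSum_pos i),
      Int.cast_le] at hle
    obtain ⟨y, ⟨hy0, hyv⟩, hy⟩ :=
      isDimensionGroup_of_linearOrder.riesz_decomposition Finset.univ hv h0 hle
    refine ⟨E.cls i y, ⟨E.nonneg_iff.2 ⟨i, y, hy0, rfl⟩, E.cls_le_cls hyv⟩, ?_⟩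
    rw [E.trace_cls, E.trace_cls, hy]

end ECSSequence

section NatMatrix

variable {ι κ : Type*} [DecidableEq ι]

/-- The matrix of a positive homomorphism `ℤ^ι → ℤ^κ`; its entries are nonnegative, so nothing is
lost by `Int.toNat`. -/
noncomputable def natMatrix (φ : (ι → ℤ) →+o (κ → ℤ)) : Matrix κ ι ℕ :=
  .of fun r j => (φ (Pi.single j 1) r).toNat

theorem natCast_natMatrix (φ : (ι → ℤ) →+o (κ → ℤ)) (r : κ) (j : ι) :
    (natMatrix φ r j : ℤ) = φ (Pi.single j 1) r :=
  Int.toNat_of_nonneg (map_single_one_nonneg φ j r)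

theorem natMatrix_map_mulVec [Fintype ι] (φ : (ι → ℤ) →+o (κ → ℤ)) (v : ι → ℤ) :
    ((natMatrix φ).map (Nat.cast : ℕ → ℤ)).mulVec v = φ v := by
  ext r
  simp only [map_eq_sum_zsmul_single φ v, Matrix.mulVec, dotProduct, Matrix.map_apply,
    natCast_natMatrix, Finset.sum_apply, Pi.smul_apply, smul_eq_mul, mul_comm]

end NatMatrix

section EqualTraceTower

variable {G : Type*} [AddCommGroup G] [PartialOrder G] {t : G →+ ℝ}

/-- A sequence of compatible equal trace levels presenting `G` as an ordered direct limit: every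
relation at a level is killed at the next one, and every positive element of `G` comes from a
nonnegative vector at some level. -/
structure EqualTraceTower (t : G →+ ℝ) where
  level : ℕ → EqualTraceLevel t
  map : ∀ i, (Fin (level i).size → ℤ) →+o (Fin (level (i + 1)).size → ℤ)
  toHom_comp_map : ∀ i, (level (i + 1)).toHom.comp (map i) = (level i).toHom
  map_eq_zero : ∀ i v, (level i).toHom v = 0 → map i v = 0
  exists_toHom_eq : ∀ a, 0 ≤ a → ∃ i v, 0 ≤ v ∧ (level i).toHom v = a

namespace EqualTraceTower

variable (T : EqualTraceTower t)

/-- The simplicial sequence formed by the matrices of the connecting maps of a tower. -/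
noncomputable def toSimplicialSequence : SimplicialSequence where
  size i := (T.level i).size
  size_pos i := (T.level i).size_pos
  mat i := natMatrix (T.map i)

theorem step_toSimplicialSequence (i : ℕ) (v : Fin (T.level i).size → ℤ) :
    T.toSimplicialSequence.step i v = T.map i v :=
  natMatrix_map_mulVec (T.map i) v

theorem sum_natMatrix_mul_val (i : ℕ) (j : Fin (T.level i).size) :
    (∑ r, natMatrix (T.map i) r j : ℕ) * (T.level (i + 1)).val = (T.level i).val := by
  have hj : t ((T.level (i + 1)).toHom (T.map i (Pi.single j 1))) = (T.level i).val := by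
    rw [← OrderAddMonoidHom.comp_apply, T.toHom_comp_map, EqualTraceLevel.trace_toHom,
      Finset.sum_pi_single', if_pos (Finset.mem_univ j), Int.cast_one, mul_one]
  rw [← hj, EqualTraceLevel.trace_toHom, mul_comm]
  simp only [← natCast_natMatrix, Nat.cast_sum, Int.cast_sum, Int.cast_natCast]

/-- The equal column sum sequence of a tower. The column sums of the `i`-th matrix, all equal to
`val i / val (i + 1)`, are read off its `0`-th column. -/
noncomputable def toECSSequence : ECSSequence where
  __ := T.toSimplicialSequence
  colSum i := ∑ r, natMatrix (T.map i) r ⟨0, (T.level i).size_pos⟩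
  colSum_pos i := Nat.pos_of_ne_zero fun h => (T.level i).val_pos.ne' <| by
    rw [← T.sum_natMatrix_mul_val i ⟨0, (T.level i).size_pos⟩, h, Nat.cast_zero, zero_mul]
  sum_col i j := Nat.cast_injective <| mul_right_cancel₀ (T.level (i + 1)).val_pos.ne' <|
    (T.sum_natMatrix_mul_val i j).trans (T.sum_natMatrix_mul_val i _).symm

theorem prod_colSum_mul_val (i : ℕ) :
    (∏ j ∈ Finset.range i, (T.toECSSequence.colSum j : ℝ)) * (T.level i).val =
      (T.level 0).val := by
  induction i with
  | zero => rw [Finset.prod_range_zero, one_mul]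
  | succ i ih =>
    rw [Finset.prod_range_succ, mul_assoc, ← ih]
    exact congrArg _ (T.sum_natMatrix_mul_val i _)

theorem trace_toHom (i : ℕ) (v : T.toECSSequence.Level i) :
    t ((T.level i).toHom v) =
      (T.level 0).val * T.toECSSequence.trace (T.toECSSequence.cls i v) := by
  have hc : (∏ j ∈ Finset.range i, (T.toECSSequence.colSum j : ℝ)) ≠ 0 :=
    (T.toECSSequence.prod_colSum_pos i).ne'
  rw [(T.level i).trace_toHom v, T.toECSSequence.trace_cls, ← T.prod_colSum_mul_val i,
    ← mul_div_assoc, mul_assoc, mul_div_cancel_left₀ _ hc]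
  rfl

theorem exists_ecsRealization [IsOrderedAddMonoid G]
    (hdir : ∀ g : G, ∃ a b : G, 0 ≤ a ∧ 0 ≤ b ∧ g = a - b) :
    ∃ R : ECSRealization G, ∀ g, t g = (T.level 0).val * R.trace g := by
  obtain ⟨e, he⟩ := SimplicialSequence.exists_limit_orderAddMonoidIso
    (S := T.toECSSequence.toSimplicialSequence) (f := fun i => (T.level i).toHom) hdir
    (fun i v => by
      rw [← T.toHom_comp_map i]
      exact congrArg _ (T.step_toSimplicialSequence i v))
    (fun i v hv => (T.step_toSimplicialSequence i v).trans (T.map_eq_zero i v hv))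
    T.exists_toHom_eq
  refine ⟨⟨T.toECSSequence, e.symm⟩, fun g => ?_⟩
  obtain ⟨x, rfl⟩ := EquivLike.surjective e g
  obtain ⟨i, v, rfl⟩ := T.toECSSequence.exists_eq_cls x
  calc t (e (T.toECSSequence.cls i v))
    _ = (T.level 0).val * T.toECSSequence.trace (T.toECSSequence.cls i v) := by
      rw [he]; exact T.trace_toHom i v
    _ = (T.level 0).val * T.toECSSequence.trace (e.symm (e (T.toECSSequence.cls i v))) := by
      rw [OrderAddMonoidIso.symm_apply_apply]

end EqualTraceTower

variable [IsOrderedAddMonoid G]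

theorem exists_equalTraceTower [Countable G] (hG : IsDimensionGroup G)
    (ht : ∀ g, 0 ≤ g → 0 ≤ t g) (hq : IsRationalTrace t) (hf : IsFaithfulTrace t)
    (hg : IsGoodTrace t) (F₀ : EqualTraceLevel t) :
    ∃ T : EqualTraceTower t, T.level 0 = F₀ := by
  have : Nonempty {a : G // 0 ≤ a} := ⟨⟨0, le_rfl⟩⟩
  obtain ⟨γ, hγ⟩ := exists_surjective_nat {a : G // 0 ≤ a}
  choose next φ hφ hker hmem using fun (F : EqualTraceLevel t) (a : {a : G // 0 ≤ a}) =>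
    F.exists_next hG ht hq hf hg a.2
  let F (i : ℕ) : EqualTraceLevel t := Nat.rec F₀ (fun i F => next F (γ i)) i
  refine ⟨⟨F, fun i => φ (F i) (γ i), fun i => hφ (F i) (γ i), fun i => hker (F i) (γ i),
    fun a ha => ?_⟩, rfl⟩
  obtain ⟨i, hi⟩ := hγ ⟨a, ha⟩
  obtain ⟨w, hw, hwa⟩ := hmem (F i) (γ i)
  exact ⟨i + 1, w, hw, hwa.trans (congrArg Subtype.val hi)⟩

theorem exists_equalTraceLevel_val_eq (hG : IsDimensionGroup G) (ht : ∀ g, 0 ≤ g → 0 ≤ t g)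
    (hg : IsGoodTrace t) {h : ℝ} (hr : h ∈ Set.range t) (h0 : 0 < h) :
    ∃ F : EqualTraceLevel t, F.val = h := by
  obtain ⟨g, rfl⟩ := hr
  obtain ⟨a, b, ha, hb, rfl⟩ := hG.directed g
  obtain ⟨x, ⟨hx, -⟩, hxt⟩ : t (a - b) ∈ t '' Set.Icc 0 a :=
    (hg a ha).ge ⟨⟨_, rfl⟩, h0.le, by rw [map_sub]; exact sub_le_self _ (ht b hb)⟩
  exact ⟨.ofFamily (κ := Unit) (y := fun _ => x) (fun _ => hx) h0 fun _ => hxt, rfl⟩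

theorem IsDimensionGroup.exists_ecsRealization [Countable G] (hG : IsDimensionGroup G)
    (ht : ∀ g, 0 ≤ g → 0 ≤ t g) (hq : IsRationalTrace t) (hf : IsFaithfulTrace t)
    (hg : IsGoodTrace t) {h : ℝ} (hr : h ∈ Set.range t) (h0 : 0 < h) :
    ∃ R : ECSRealization G, ∀ g, t g = h * R.trace g := by
  obtain ⟨F₀, rfl⟩ := exists_equalTraceLevel_val_eq hG ht hg hr h0
  obtain ⟨T, rfl⟩ := exists_equalTraceTower hG ht hq hf hg F₀
  exact T.exists_ecsRealization hG.directed

end EqualTraceTower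
section Transfer

variable {G H : Type*} [AddCommGroup G] [AddCommGroup H] {t : G →+ ℝ} {s : H →+ ℝ}

theorem IsRationalTrace.of_eq_mul_comp (hs : IsRationalTrace s) {e : G → H} {q : ℚ}
    (ht : ∀ g, t g = q * s (e g)) : IsRationalTrace t := fun g => by
  obtain ⟨r, hr⟩ := hs (e g)
  exact ⟨q * r, by rw [ht, hr, Rat.cast_mul]⟩

variable [PartialOrder G] [PartialOrder H] {e : G ≃+o H} {c : ℝ}

theorem IsFaithfulTrace.of_eq_mul_comp (hs : IsFaithfulTrace s) (hc : 0 < c)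
    (ht : ∀ g, t g = c * s (e g)) : IsFaithfulTrace t := fun g hg h => by
  rw [ht, mul_eq_zero, or_iff_right hc.ne'] at h
  exact (map_eq_zero_iff e (EquivLike.injective e)).1 (hs _ (map_nonneg e hg) h)

theorem IsGoodTrace.of_eq_mul_comp (hs : IsGoodTrace s) (hc : 0 < c)
    (ht : ∀ g, t g = c * s (e g)) : IsGoodTrace t := by
  intro b hb
  let m : ℝ ≃o ℝ := OrderIso.mulLeft₀ c hc
  have hcomp : ⇑t = m ∘ s ∘ e := funext ht
  have himage : e '' Set.Icc 0 b = Set.Icc 0 (e b) := by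
    rw [← map_zero e]
    exact (e : G ≃o H).image_Icc 0 b
  have hrange : m '' Set.range s = Set.range t := by
    rw [hcomp, ← Set.range_comp, ← Function.comp_assoc, (EquivLike.surjective e).range_comp]
  calc t '' Set.Icc 0 b
    _ = m '' (s '' Set.Icc 0 (e b)) := by rw [hcomp, Set.image_comp, Set.image_comp, himage]
    _ = m '' Set.range s ∩ m '' Set.Icc 0 (s (e b)) := by
      rw [hs _ (map_nonneg e hb), Set.image_inter m.injective]
    _ = Set.range t ∩ Set.Icc 0 (t b) := by
      rw [hrange, m.image_Icc, ht b]
      simp [m]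

end Transfer

theorem ECSRealization.faithful_good_rational {G : Type*} [AddCommGroup G] [PartialOrder G]
    (R : ECSRealization G) {t : G →+ ℝ} {q : ℚ} (hq : 0 < q) (ht : ∀ g, t g = q * R.trace g) :
    IsFaithfulTrace t ∧ IsGoodTrace t ∧ IsRationalTrace t :=
  have hq' : (0 : ℝ) < q := Rat.cast_pos.2 hq
  have ht' (g : G) : t g = q * R.seq.trace (R.iso g) := ht g
  ⟨R.seq.isFaithfulTrace_trace.of_eq_mul_comp hq' ht',
    R.seq.isGoodTrace_trace.of_eq_mul_comp hq' ht',
    R.seq.isRationalTrace_trace.of_eq_mul_comp ht'⟩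

theorem exists_map_pos_of_ne_zero {G : Type*} [AddCommGroup G] {t : G →+ ℝ} (ht : t ≠ 0) :
    ∃ g, 0 < t g := by
  obtain ⟨g, hg⟩ := DFunLike.ne_iff.1 ht
  rcases lt_or_gt_of_ne hg with h | h
  · exact ⟨-g, by rw [map_neg]; exact neg_pos.2 h⟩
  · exact ⟨g, h⟩

theorem theorem6p1_general {G : Type*} [AddCommGroup G] [PartialOrder G] [IsOrderedAddMonoid G]
    (hG : IsDimensionGroup G) (t : G →+ ℝ) (ht : IsTrace t) :
    (∀ (R : ECSRealization G) (q : ℚ), 0 < q → (∀ g : G, t g = (q : ℝ) * R.trace g) →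
      IsFaithfulTrace t ∧ IsGoodTrace t ∧ IsRationalTrace t) ∧
    (Countable G → IsRationalTrace t → IsFaithfulTrace t → IsGoodTrace t →
      (∃ (R : ECSRealization G) (q : ℚ), 0 < q ∧ ∀ g : G, t g = (q : ℝ) * R.trace g) ∧
      ((∃ g : G, t g = 1) → ∃ R : ECSRealization G, t = R.trace)) := by
  refine ⟨fun R q hq h => R.faithful_good_rational hq h, fun _ hq hf hg => ⟨?_, fun h1 => ?_⟩⟩
  · obtain ⟨g, hpos⟩ := exists_map_pos_of_ne_zero ht.2
    obtain ⟨R, hR⟩ := hG.exists_ecsRealization ht.1 hq hf hg ⟨g, rfl⟩ hpos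
    obtain ⟨q, htq⟩ := hq g
    rw [htq] at hpos hR
    exact ⟨R, q, Rat.cast_pos.1 hpos, hR⟩
  · obtain ⟨R, hR⟩ := hG.exists_ecsRealization ht.1 hq hf hg h1 one_pos
    exact ⟨R, by ext g; rw [hR, one_mul]⟩

theorem theorem6p1 {G : Type*} [AddCommGroup G] [PartialOrder G] [IsOrderedAddMonoid G]
    (hG : IsDimensionGroup G) (u : G) (hu : IsOrderUnit u) (t : G →+ ℝ) (ht : IsTrace t) :
    (∀ (R : ECSRealization G) (q : ℚ), 0 < q → (∀ g : G, t g = (q : ℝ) * R.trace g) →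
      IsFaithfulTrace t ∧ IsGoodTrace t ∧ IsRationalTrace t) ∧
    (Countable G → IsRationalTrace t → IsFaithfulTrace t → IsGoodTrace t →
      (∃ (R : ECSRealization G) (q : ℚ), 0 < q ∧ ∀ g : G, t g = (q : ℝ) * R.trace g) ∧
      ((∃ g : G, t g = 1) → ∃ R : ECSRealization G, t = R.trace)) :=
  theorem6p1_general hG t ht
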